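/- Let $d\ge 1$, let $\Omega\subset\mathbb R^d$ be a bounded open set, and let $V=H^1_0(\Omega)$ (real-valued) with inner product $(g,h)_{H^1_0}=(\nabla g,\nabla h)_{L^2}$. Let $T>0$ and $\nu>0$. There is a constant $C>0$, depending only on $\Omega$, $T$ and $\nu$, such that the following holds. Let $N\ge 2$, $\Delta t=T/(N-1)$, let $V^h\subset V$ be a finite-dimensional subspace, let $f^n\in L^2(\Omega)$, and let $u^1,\dots,u^N\in V^h$ satisfy the backward Euler scheme $$\Big(\tfrac{u^{n+1}-u^n}{\Delta t},v\Big)_{L^2}+\nu(\nabla u^{n+1},\nabla v)_{L^2}=(f^{n+1},v)_{L^2}\qquad\forall v\in V^h,\quad n=1,\dots,N-1.$$ Put $\partial u^n=(u^{n+1}-u^n)/\Delta t$ and let $S=\mathbb R^N$ with the inner product $(g,h)_S=\sum_{j=1}^N\gamma_jg^jh^j$, where $\gamma_1=1$ and $\gamma_2=\dots=\gamma_N=\Delta t$. Let $\{(\lambda_i^{DQ1})^{1/2},f_i,\varphi_i\}_{i=1}^m$ be a singular value decomposition (with nonincreasing nonnegative singular values, $f_i$ orthonormal in $S$, and $\varphi_i$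 orthonormal in $H^1_0(\Omega)$) of the operator $$K_1:S\to H^1_0(\Omega),\qquad K_1g=g^1u^1+\sum_{j=1}^{N-1}\Delta t\,g^{j+1}\,\partial u^j,$$ let $s$ be the number of positive singular values, let $0\le r\le m$ with $\varphi_1,\dots,\varphi_r\in V^h$, and put $V^h_r=\operatorname{span}\{\varphi_1,\dots,\varphi_r\}$ and $\Pi_ru=\sum_{i=1}^r(u,\varphi_i)_{H^1_0}\varphi_i$. Let $u_r^1,\dots,u_r^N\in V_r^h$ satisfy $$\Big(\tfrac{u_r^{n+1}-u_r^n}{\Delta t},v_r\Big)_{L^2}+\nu(\nabla u_r^{n+1},\nabla v_r)_{L^2}=(f^{n+1},v_r)_{L^2}\qquad\forall v_r\in V^h_r,\quad n=1,\dots,N-1,$$ and put $e^n=u^n-u_r^n$ and $\phi_r^1=u_r^1-\Pi_ru^1$. Then $\Pi_r$ is the one and only Ritz projection onto $V_r^h$, i.e. the only map $R:V\to V_r^h$ with $(\nabla(w-Rw),\nabla v_r)_{L^2}=0$ for all $w\in V$, $v_r\in V_r^h$; and $$\max_{1\le k\le N}\|e^k\|_{L^2}^2\le C\Big(\sum_{i=r+1}^s\lambda_i^{DQ1}\|\varphi_i\|_{L^2}^2+\|\phi_r^1\|_{L^2}^2\Big),$$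 $$\max_{1\le k\le N}\|\nabla e^k\|_{L^2}^2\le C\Big(\sum_{i=r+1}^s\lambda_i^{DQ1}\big(\|\varphi_i\|_{L^2}^2+1\big)+\|\phi_r^1\|_{H^1_0}^2\Big),$$ $$\|e^N\|_{L^2}^2+\nu\Delta t\sum_{n=1}^{N-1}\|\nabla e^{n+1}\|_{L^2}^2\le C\Big(\sum_{i=r+1}^s\lambda_i^{DQ1}\big(1+\|\varphi_i\|_{L^2}^2\big)+\|\phi_r^1\|_{L^2}^2\Big).$$ -/

import Mathlib

open MeasureTheory
open scoped ContDiff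

noncomputable section

/-! ### The spaces `L²(Ω)`, `H¹(Ω)` and `H¹₀(Ω)` -/

/-- The Euclidean space `ℝᵈ`. -/
abbrev Rd (d : ℕ) : Type := EuclideanSpace ℝ (Fin d)

/-- The real space `L²(Ω)`. -/
abbrev L2 {d : ℕ} (Ω : Set (Rd d)) : Type :=
  Lp ℝ 2 ((volume : Measure (Rd d)).restrict Ω)

/-- The space `L²(Ω; ℝᵈ)` of square integrable vector fields. -/
abbrev L2Vec {d : ℕ} (Ω : Set (Rd d)) : Type :=
  Lp (Rd d) 2 ((volume : Measure (Rd d)).restrict Ω)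

/-- Test functions on `Ω`, the class `C_c^∞(Ω)`. -/
def IsTestFunction {d : ℕ} (Ω : Set (Rd d)) (ψ : Rd d → ℝ) : Prop :=
  ContDiff ℝ ∞ ψ ∧ HasCompactSupport ψ ∧ tsupport ψ ⊆ Ω

/-- `G ∈ L²(Ω; ℝᵈ)` is the weak gradient of `u ∈ L²(Ω)`: for all test functions `ψ` and all
directions `a`, `∫_Ω u ∂ₐψ = - ∫_Ω (G · a) ψ`. -/
def HasWeakGradient {d : ℕ} (Ω : Set (Rd d)) (u : L2 Ω) (G : L2Vec Ω) : Prop :=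
  ∀ ψ : Rd d → ℝ, IsTestFunction Ω ψ → ∀ a : Rd d,
    ∫ x in Ω, u x * fderiv ℝ ψ x a = - ∫ x in Ω, inner ℝ (G x) a * ψ x

lemma IsTestFunction.memLp {d : ℕ} {Ω : Set (Rd d)} {ψ : Rd d → ℝ} (h : IsTestFunction Ω ψ) :
    MemLp ψ 2 ((volume : Measure (Rd d)).restrict Ω) :=
  (h.1.continuous.memLp_of_hasCompactSupport h.2.1).restrict Ω

lemma IsTestFunction.memLp_fderiv {d : ℕ} {Ω : Set (Rd d)} {ψ : Rd d → ℝ}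
    (h : IsTestFunction Ω ψ) (a : Rd d) :
    MemLp (fun x => fderiv ℝ ψ x a) 2 ((volume : Measure (Rd d)).restrict Ω) :=
  (((h.1.continuous_fderiv (by simp)).clm_apply continuous_const).memLp_of_hasCompactSupport
    (h.2.1.fderiv_apply (𝕜 := ℝ) a)).restrict Ω

/-- The Sobolev space `H¹(Ω)`, each function being recorded together with its weak gradient,
i.e. the pairs `(u, ∇u)` with `u ∈ L²(Ω)` and weak gradient `∇u ∈ L²(Ω; ℝᵈ)`. The product topology
on the pairs is the topology of the `H¹` norm. -/
def H1 {d : ℕ} (Ω : Set (Rd d)) : Submodule ℝ (L2 Ω × L2Vec Ω) where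
  carrier := {p | HasWeakGradient Ω p.1 p.2}
  zero_mem' := by
    intro ψ hψ a
    have h1 : ∫ x in Ω, (0 : L2 Ω) x * fderiv ℝ ψ x a = 0 := by
      rw [← integral_zero (Rd d) ℝ (μ := volume.restrict Ω)]
      refine integral_congr_ae ?_
      filter_upwards [Lp.coeFn_zero ℝ 2 ((volume : Measure (Rd d)).restrict Ω)] with x hx
      rw [hx]; simp
    have h2 : ∫ x in Ω, inner ℝ ((0 : L2Vec Ω) x) a * ψ x = 0 := by
      rw [← integral_zero (Rd d) ℝ (μ := volume.restrict Ω)]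
      refine integral_congr_ae ?_
      filter_upwards [Lp.coeFn_zero (Rd d) 2 ((volume : Measure (Rd d)).restrict Ω)] with x hx
      rw [hx]; simp
    change ∫ x in Ω, (0 : L2 Ω) x * fderiv ℝ ψ x a = - ∫ x in Ω, inner ℝ ((0 : L2Vec Ω) x) a * ψ x
    rw [h1, h2, neg_zero]
  add_mem' := by
    intro p q hp hq ψ hψ a
    have i1 : ∀ v : L2 Ω, Integrable (fun x => v x * fderiv ℝ ψ x a) (volume.restrict Ω) :=
      fun v => (Lp.memLp v).integrable_mul (hψ.memLp_fderiv a)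
    have i2 : ∀ G : L2Vec Ω, Integrable (fun x => inner ℝ (G x) a * ψ x) (volume.restrict Ω) :=
      fun G => ((Lp.memLp G).inner_const a).integrable_mul hψ.memLp
    have h1 : ∫ x in Ω, (p.1 + q.1) x * fderiv ℝ ψ x a
        = ∫ x in Ω, (p.1 x * fderiv ℝ ψ x a + q.1 x * fderiv ℝ ψ x a) := by
      refine integral_congr_ae ?_
      filter_upwards [Lp.coeFn_add p.1 q.1] with x hx
      rw [hx, Pi.add_apply, add_mul]
    have h2 : ∫ x in Ω, inner ℝ ((p.2 + q.2) x) a * ψ x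
        = ∫ x in Ω, (inner ℝ (p.2 x) a * ψ x + inner ℝ (q.2 x) a * ψ x) := by
      refine integral_congr_ae ?_
      filter_upwards [Lp.coeFn_add p.2 q.2] with x hx
      rw [hx, Pi.add_apply, inner_add_left, add_mul]
    rw [integral_add (i1 _) (i1 _)] at h1
    rw [integral_add (i2 _) (i2 _)] at h2
    have e1 := hp ψ hψ a
    have e2 := hq ψ hψ a
    change ∫ x in Ω, (p.1 + q.1) x * fderiv ℝ ψ x a = - ∫ x in Ω, inner ℝ ((p.2 + q.2) x) a * ψ x
    rw [h1, h2, e1, e2]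
    ring
  smul_mem' := by
    intro c p hp ψ hψ a
    have h1 : ∫ x in Ω, (c • p.1) x * fderiv ℝ ψ x a = c * ∫ x in Ω, p.1 x * fderiv ℝ ψ x a := by
      rw [← integral_const_mul]
      refine integral_congr_ae ?_
      filter_upwards [Lp.coeFn_smul c p.1] with x hx
      rw [hx, Pi.smul_apply, smul_eq_mul, mul_assoc]
    have h2 : ∫ x in Ω, inner ℝ ((c • p.2) x) a * ψ x
        = c * ∫ x in Ω, inner ℝ (p.2 x) a * ψ x := by
      rw [← integral_const_mul]
      refine integral_congr_ae ?_
      filter_upwards [Lp.coeFn_smul c p.2] with x hx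
      rw [hx, Pi.smul_apply, real_inner_smul_left, mul_assoc]
    change ∫ x in Ω, (c • p.1) x * fderiv ℝ ψ x a = - ∫ x in Ω, inner ℝ ((c • p.2) x) a * ψ x
    rw [h1, h2, hp ψ hψ a]
    ring

/-- The set of pairs `(ψ, ∇ψ)` with `ψ ∈ C_c^∞(Ω)`. -/
def testPairs {d : ℕ} (Ω : Set (Rd d)) : Set (L2 Ω × L2Vec Ω) :=
  {p | ∃ ψ : Rd d → ℝ, IsTestFunction Ω ψ ∧
    (p.1 : Rd d → ℝ) =ᵐ[volume.restrict Ω] ψ ∧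
    (p.2 : Rd d → Rd d) =ᵐ[volume.restrict Ω] fun x => gradient ψ x}

/-- `H¹₀(Ω)`: the closure of `C_c^∞(Ω)` in `H¹(Ω)`. -/
def H01 {d : ℕ} (Ω : Set (Rd d)) : Submodule ℝ (L2 Ω × L2Vec Ω) :=
  H1 Ω ⊓ (Submodule.span ℝ (testPairs Ω)).topologicalClosure

variable {d : ℕ} {Ω : Set (Rd d)}

/-- The inclusion `H¹₀(Ω) → L²(Ω)`, `u ↦ u`. -/
def toL2 : H01 Ω →ₗ[ℝ] L2 Ω := LinearMap.fst ℝ (L2 Ω) (L2Vec Ω) ∘ₗ (H01 Ω).subtype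

/-- The gradient `H¹₀(Ω) → L²(Ω; ℝᵈ)`, `u ↦ ∇u`. -/
def grad : H01 Ω →ₗ[ℝ] L2Vec Ω := LinearMap.snd ℝ (L2 Ω) (L2Vec Ω) ∘ₗ (H01 Ω).subtype

/-- The inner product `(g, h)_{H¹₀} = (∇g, ∇h)_{L²}`. The corresponding norm is `‖grad g‖`. -/
def h01Inner (g h : H01 Ω) : ℝ := inner ℝ (grad g) (grad h)

/-! ### Proper orthogonal decomposition in `H¹₀(Ω)` -/

/-- The weighted inner product `(f, g)_S = ∑ γ_j f^j g^j` on `S = ℝ^M`. -/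
def weightedInner {M : ℕ} (γ f g : Fin M → ℝ) : ℝ := ∑ j, γ j * f j * g j

/-- The POD operator `K : S → H¹₀(Ω)`, `K f = ∑ γ_j f^j w^j`, of the data `w` with weights `γ`. -/
def podOperator {M : ℕ} (γ : Fin M → ℝ) (w : Fin M → H01 Ω) (f : Fin M → ℝ) : H01 Ω :=
  ∑ j, (γ j * f j) • w j

/-- `{lam_k^{1/2}, f_k, φ_k}` is a singular value decomposition of the POD operator `K : S → X` with
POD space `X = H¹₀(Ω)`: the singular values are nonnegative and nonincreasing, the `f_k` are
orthonormal in `S`, the `φ_k` (the POD modes) are orthonormal in `H¹₀(Ω)`, and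
`K g = ∑ lam_k^{1/2} (g, f_k)_S φ_k`. The numbers `lam_k` are the POD eigenvalues. -/
structure IsPODSVD {M m : ℕ} (γ : Fin M → ℝ) (w : Fin M → H01 Ω)
    (lam : Fin m → ℝ) (f : Fin m → Fin M → ℝ) (φ : Fin m → H01 Ω) : Prop where
  nonneg : ∀ k, 0 ≤ lam k
  antitone : Antitone lam
  orthonormal_S : ∀ i k, weightedInner γ (f i) (f k) = if i = k then 1 else 0
  orthonormal_X : ∀ i k, h01Inner (φ i) (φ k) = if i = k then 1 else 0
  expansion : ∀ g : Fin M → ℝ,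
    podOperator γ w g = ∑ k, (Real.sqrt (lam k) * weightedInner γ g (f k)) • φ k

/-- The time step `Δt = T / (N - 1)`. -/
def timeStep (T : ℝ) (N : ℕ) : ℝ := T / ((N : ℝ) - 1)

/-- The difference quotient `∂u^n = (u^{n+1} - u^n) / Δt`. -/
def diffQuot (dt : ℝ) (u : ℕ → H01 Ω) (n : ℕ) : H01 Ω := dt⁻¹ • (u (n + 1) - u n)

/-- The data set of the new difference quotient approach, for snapshots `u^1, …, u^N`:
first `u^1`, then `∂u^1, …, ∂u^{N-1}` (`Fin N` counts from `0`). -/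
def dq1Data (N : ℕ) (dt : ℝ) (u : ℕ → H01 Ω) (j : Fin N) : H01 Ω :=
  if (j : ℕ) = 0 then u 1 else diffQuot dt u j

/-- The weights of the new difference quotient approach: `1, Δt, …, Δt`. -/
def dq1Weights (N : ℕ) (dt : ℝ) (j : Fin N) : ℝ := if (j : ℕ) = 0 then 1 else dt

/-- The number `s` of positive POD singular values. -/
def numPos {m : ℕ} (lam : Fin m → ℝ) : ℕ := (Finset.univ.filter fun i => 0 < lam i).card

/-- `∑_{i=r+1}^{s} lam_i a_i` (the 1-based index `i` is the element `i - 1` of `Fin m`). -/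
def podTail {m : ℕ} (lam : Fin m → ℝ) (r : ℕ) (a : Fin m → ℝ) : ℝ :=
  ∑ i ∈ Finset.univ.filter (fun i : Fin m => r ≤ (i : ℕ) ∧ (i : ℕ) < numPos lam), lam i * a i

/-- `V_r^h = span {φ_1, …, φ_r}`. -/
def podSpace {m : ℕ} (φ : Fin m → H01 Ω) (r : ℕ) : Submodule ℝ (H01 Ω) :=
  Submodule.span ℝ (φ '' {i | (i : ℕ) < r})

/-- The `H¹₀`-orthogonal POD projection `Π_r u = ∑_{i=1}^r (u, φ_i)_{H¹₀} φ_i`. -/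
def podProj {m : ℕ} (φ : Fin m → H01 Ω) (r : ℕ) (u : H01 Ω) : H01 Ω :=
  ∑ i ∈ Finset.univ.filter (fun i : Fin m => (i : ℕ) < r), h01Inner u (φ i) • φ i

/-- `R` is the Ritz projection onto `W`: `(∇(w - R w), ∇v)_{L²} = 0` for all `v ∈ W`. -/
def IsRitzProjection (W : Submodule ℝ (H01 Ω)) (R : H01 Ω → H01 Ω) : Prop :=
  ∀ w, R w ∈ W ∧ ∀ v ∈ W, inner ℝ (grad (w - R w)) (grad v) = 0

/-! ### The backward Euler Galerkin scheme for the heat equation -/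

/-- `u^1, …, u^N ∈ W` solve the backward Euler Galerkin scheme in `W ⊆ H¹₀(Ω)`: for
`n = 1, …, N-1` and all `v ∈ W`,
`((u^{n+1} - u^n)/Δt, v)_{L²} + ν (∇u^{n+1}, ∇v)_{L²} = (F^{n+1}, v)_{L²}`. -/
def IsBackwardEuler (W : Submodule ℝ (H01 Ω)) (N : ℕ) (dt ν : ℝ) (F : ℕ → L2 Ω)
    (u : ℕ → H01 Ω) : Prop :=
  (∀ n ∈ Finset.Icc 1 N, u n ∈ W) ∧
  ∀ n ∈ Finset.Icc 1 (N - 1), ∀ v ∈ W,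
    inner ℝ (toL2 (diffQuot dt u n)) (toL2 v) + ν * inner ℝ (grad (u (n + 1))) (grad v)
      = inner ℝ (F (n + 1)) (toL2 v)

end

/-! Split `u k - ur k` as `η k - p k`, where `η k = u k - podProj φ r (u k)` is the projection error
and `p k = ur k - podProj φ r (u k)` lies in the POD space.

The snapshots are `u 1` and the difference quotients, so the POD error formula
(`IsPODSVD.dq1_error`) evaluates exactly the norm of `η 1` together with the time-weighted norms of
the quotients of `η`, in `L²` and in `H¹₀` alike. Every `η k` is `η 1` plus a sum of increments, so
Cauchy–Schwarz in time (`norm_sq_le_of_diffQuot`) turns this into a pointwise bound depending only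
on `T`.

Subtracting the two schemes cancels the forcing, and Ritz orthogonality removes the gradient of `η`.
Hence `p` solves a discrete heat equation with right-hand side the difference quotient of `η`
(`error_equation`), which the same formula controls. Testing with `p (n + 1)` gives the `L²` and
dissipation bounds (`energy_step_L2`); testing with the difference quotient of `p` gives the `H¹₀`
bound (`energy_step_grad`). Poincaré's inequality enters the first energy estimate and the
uniqueness of the Ritz projection. -/

/-! ### Poincaré's inequality on a bounded open set. -/

/-- Poincaré's inequality for test functions supported in a slab `|⟪a, x⟫| ≤ R`. -/
lemma IsTestFunction.integral_sq_le {d : ℕ} {Ω : Set (Rd d)} (hΩ : IsOpen Ω) {a : Rd d}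
    (ha : ‖a‖ = 1) {R : ℝ} (hR : ∀ x ∈ Ω, |inner ℝ a x| ≤ R) {ψ : Rd d → ℝ}
    (h : IsTestFunction Ω ψ) :
    ∫ x in Ω, ψ x ^ 2 ≤ 4 * R ^ 2 * ∫ x in Ω, ‖gradient ψ x‖ ^ 2 := by
  have hzero : ∀ x, x ∉ Ω → ψ x = 0 := fun x hx =>
    image_eq_zero_of_notMem_tsupport fun hx' => hx (h.2.2 hx')
  have hψd : Differentiable ℝ ψ := h.1.differentiable (by simp)
  have hψc : Continuous ψ := h.1.continuous
  have hψ' : Continuous fun x => fderiv ℝ ψ x a :=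
    (h.1.continuous_fderiv (by simp)).clm_apply continuous_const
  have hint : ∀ g : Rd d → ℝ, Continuous g → (∀ x, ψ x = 0 → g x = 0) → Integrable g :=
    fun g hg h0 => hg.integrable_of_hasCompactSupport <|
      h.2.1.mono fun x hx hψx => hx (h0 x hψx)
  have hfd : ∀ x, fderiv ℝ (fun x => ψ x ^ 2) x a = 2 * ψ x * fderiv ℝ ψ x a := by
    intro x
    rw [((hψd x).hasFDerivAt.pow 2).fderiv]
    simp
  have hin : ∀ x, fderiv ℝ (fun x : Rd d => inner ℝ a x) x a = 1 := by
    intro x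
    have : HasFDerivAt (fun x : Rd d => inner ℝ a x) (innerSL ℝ a) x :=
      (innerSL ℝ a).hasFDerivAt
    rw [this.fderiv]
    simp [ha]
  have hac : Continuous fun x : Rd d => inner ℝ a x := by fun_prop
  have i0 : Integrable fun x => ψ x ^ 2 := hint _ (hψc.pow 2) fun x hx => by simp [hx]
  have i1 : Integrable fun x => inner ℝ a x * ψ x ^ 2 :=
    hint _ (hac.mul (hψc.pow 2)) fun x hx => by simp [hx]
  have i2 : Integrable fun x => inner ℝ a x * (2 * ψ x * fderiv ℝ ψ x a) :=
    hint _ (hac.mul ((continuous_const.mul hψc).mul hψ')) fun x hx => by simp [hx]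
  -- The linear function `⟪a, x⟫` has derivative `1` in the direction `a`, so integrating by parts
  -- against it produces the integral of `ψ ^ 2`.
  have hparts : ∫ x, inner ℝ a x * (2 * ψ x * fderiv ℝ ψ x a) = - ∫ x, ψ x ^ 2 := by
    have := integral_mul_fderiv_eq_neg_fderiv_mul_of_integrable (𝕜 := ℝ)
      (μ := (volume : Measure (Rd d))) (f := fun x => inner ℝ a x) (g := fun x => ψ x ^ 2) (v := a)
      (i0.congr (.of_forall fun x => by simp only [hin, one_mul]))
      (i2.congr (.of_forall fun x => by simp only [hfd]))
      i1 (fun x _ => (innerSL ℝ a).differentiableAt) (fun x _ => (hψd x).pow 2)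
    simpa only [hfd, hin, one_mul] using this
  have e1 : ∫ x in Ω, ψ x ^ 2 = ∫ x, ψ x ^ 2 :=
    setIntegral_eq_integral_of_forall_compl_eq_zero fun x hx => by simp [hzero x hx]
  have e2 : ∫ x in Ω, inner ℝ a x * (2 * ψ x * fderiv ℝ ψ x a)
      = ∫ x, inner ℝ a x * (2 * ψ x * fderiv ℝ ψ x a) :=
    setIntegral_eq_integral_of_forall_compl_eq_zero fun x hx => by simp [hzero x hx]
  have hg2 : Integrable (fun x => ‖gradient ψ x‖ ^ 2) (volume.restrict Ω) := by
    have hc : Continuous fun x => fderiv ℝ ψ x := h.1.continuous_fderiv (by simp)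
    have : ∀ x, ‖gradient ψ x‖ = ‖fderiv ℝ ψ x‖ := fun x => by simp [gradient]
    simp only [this]
    have hcs : HasCompactSupport fun x => ‖fderiv ℝ ψ x‖ ^ 2 :=
      (h.2.1.fderiv (𝕜 := ℝ)).mono fun x hx h0 => hx (by simp [h0])
    have hi : Integrable (fun x => ‖fderiv ℝ ψ x‖ ^ 2) volume :=
      (hc.norm.pow 2).integrable_of_hasCompactSupport hcs
    exact hi.restrict
  have hψ2 : Integrable (fun x => ψ x ^ 2) (volume.restrict Ω) := i0.restrict
  have hle : ∫ x in Ω, -(inner ℝ a x * (2 * ψ x * fderiv ℝ ψ x a))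
      ≤ ∫ x in Ω, (1 / 2 * ψ x ^ 2 + 2 * R ^ 2 * ‖gradient ψ x‖ ^ 2) := by
    refine setIntegral_mono_on i2.restrict.neg ((hψ2.const_mul _).add (hg2.const_mul _))
      hΩ.measurableSet fun x hx => ?_
    have h1 : fderiv ℝ ψ x a ^ 2 ≤ ‖gradient ψ x‖ ^ 2 := by
      rw [← inner_gradient_left]
      refine sq_le_sq' ?_ ?_
      · have := abs_real_inner_le_norm (gradient ψ x) a
        rw [ha, mul_one] at this
        exact (abs_le.1 this).1
      · have := abs_real_inner_le_norm (gradient ψ x) a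
        rw [ha, mul_one] at this
        exact (abs_le.1 this).2
    have h2 : inner ℝ a x ^ 2 ≤ R ^ 2 := sq_le_sq' (abs_le.1 (hR x hx)).1 (abs_le.1 (hR x hx)).2
    have h3 : inner ℝ a x ^ 2 * fderiv ℝ ψ x a ^ 2 ≤ R ^ 2 * ‖gradient ψ x‖ ^ 2 :=
      mul_le_mul h2 h1 (sq_nonneg _) (sq_nonneg _)
    -- Young's inequality with weight `1 / 2` on `ψ ^ 2`: that half is absorbed on the left at the
    -- end, which turns `2 * R ^ 2` into `4 * R ^ 2`.
    nlinarith [sq_nonneg (ψ x + 2 * (inner ℝ a x * fderiv ℝ ψ x a))]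
  rw [integral_neg, e2, hparts, neg_neg, ← e1, integral_add (hψ2.const_mul _) (hg2.const_mul _),
    integral_const_mul, integral_const_mul] at hle
  linarith

lemma Lp_norm_sq_eq_integral {α E : Type*} [MeasurableSpace α] {μ : Measure α}
    [NormedAddCommGroup E] [InnerProductSpace ℝ E] (g : Lp E 2 μ) :
    ‖g‖ ^ 2 = ∫ x, ‖g x‖ ^ 2 ∂μ := by
  rw [← real_inner_self_eq_norm_sq, L2.inner_def]
  simp only [real_inner_self_eq_norm_sq]

lemma IsTestFunction.zero {d : ℕ} {Ω : Set (Rd d)} : IsTestFunction Ω (fun _ => 0) :=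
  ⟨contDiff_const, HasCompactSupport.zero, by simp [tsupport, Function.support]⟩

lemma IsTestFunction.add {d : ℕ} {Ω : Set (Rd d)} {ψ χ : Rd d → ℝ} (h : IsTestFunction Ω ψ)
    (h' : IsTestFunction Ω χ) : IsTestFunction Ω (fun x => ψ x + χ x) :=
  ⟨h.1.add h'.1, h.2.1.add h'.2.1, (tsupport_add ψ χ).trans (Set.union_subset h.2.2 h'.2.2)⟩

lemma IsTestFunction.const_mul {d : ℕ} {Ω : Set (Rd d)} {ψ : Rd d → ℝ} (h : IsTestFunction Ω ψ)
    (c : ℝ) : IsTestFunction Ω (fun x => c * ψ x) :=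
  ⟨contDiff_const.mul h.1, h.2.1.mul_left, (tsupport_mul_subset_right).trans h.2.2⟩

/-- Test functions and their gradients are stable under linear combinations, so an inequality for
test functions needs no further argument on the span. -/
lemma span_testPairs_subset {d : ℕ} (Ω : Set (Rd d)) :
    (Submodule.span ℝ (testPairs Ω) : Set (L2 Ω × L2Vec Ω)) ⊆ testPairs Ω := by
  intro p hp
  induction hp using Submodule.span_induction with
  | mem p hp => exact hp
  | zero =>
    refine ⟨_, IsTestFunction.zero, Lp.coeFn_zero ℝ 2 _, ?_⟩
    filter_upwards [Lp.coeFn_zero (Rd d) 2 ((volume : Measure (Rd d)).restrict Ω)] with x hx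
    rw [Prod.snd_zero, hx]
    simp [gradient]
  | add p q _ _ hp hq =>
    obtain ⟨ψ, hψ, h1, h2⟩ := hp
    obtain ⟨χ, hχ, k1, k2⟩ := hq
    refine ⟨_, hψ.add hχ, ?_, ?_⟩
    · filter_upwards [Lp.coeFn_add p.1 q.1, h1, k1] with x e1 e2 e3
      rw [Prod.fst_add, e1, Pi.add_apply, e2, e3]
    · filter_upwards [Lp.coeFn_add p.2 q.2, h2, k2] with x e1 e2 e3
      rw [Prod.snd_add, e1, Pi.add_apply, e2, e3, gradient, gradient, gradient,
        fderiv_fun_add (hψ.1.differentiable (by simp) x) (hχ.1.differentiable (by simp) x), map_add]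
  | smul c p _ hp =>
    obtain ⟨ψ, hψ, h1, h2⟩ := hp
    refine ⟨_, hψ.const_mul c, ?_, ?_⟩
    · filter_upwards [Lp.coeFn_smul c p.1, h1] with x e1 e2
      rw [Prod.smul_fst, e1, Pi.smul_apply, e2, smul_eq_mul]
    · filter_upwards [Lp.coeFn_smul c p.2, h2] with x e1 e2
      rw [Prod.smul_snd, e1, Pi.smul_apply, e2, gradient, gradient,
        fderiv_const_mul (hψ.1.differentiable (by simp) x), map_smul]

/-- Poincaré's inequality on `H¹₀(Ω)` for bounded open `Ω`. -/
lemma exists_poincare {d : ℕ} (hd : 1 ≤ d) {Ω : Set (Rd d)} (hΩ : IsOpen Ω)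
    (hΩb : Bornology.IsBounded Ω) :
    ∃ P : ℝ, ∀ v : H01 Ω, ‖toL2 v‖ ≤ P * ‖grad v‖ := by
  obtain ⟨R, hR0, hR⟩ := hΩb.exists_pos_norm_le
  refine ⟨2 * R, ?_⟩
  -- The inequality is a closed condition on pairs, so it passes from test pairs to the closure
  -- defining `H01 Ω`.
  have hcl : IsClosed {p : L2 Ω × L2Vec Ω | ‖p.1‖ ≤ 2 * R * ‖p.2‖} :=
    isClosed_le (by fun_prop) (by fun_prop)
  have hsub : (Submodule.span ℝ (testPairs Ω) : Set (L2 Ω × L2Vec Ω))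
      ⊆ {p : L2 Ω × L2Vec Ω | ‖p.1‖ ≤ 2 * R * ‖p.2‖} := by
    refine (span_testPairs_subset Ω).trans ?_
    rintro p ⟨ψ, hψ, h1, h2⟩
    -- Any unit vector serves as slab direction; one exists because `1 ≤ d`.
    have ha : ‖(EuclideanSpace.single (⟨0, hd⟩ : Fin d) (1 : ℝ) : Rd d)‖ = 1 := by simp
    have key := hψ.integral_sq_le hΩ ha (R := R) fun x hx => by
      refine (abs_real_inner_le_norm _ _).trans ?_
      rw [ha, one_mul]
      exact hR x hx
    have e1 : ‖p.1‖ ^ 2 = ∫ x in Ω, ψ x ^ 2 := by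
      rw [Lp_norm_sq_eq_integral]
      refine integral_congr_ae ?_
      filter_upwards [h1] with x hx
      rw [hx, Real.norm_eq_abs, sq_abs]
    have e2 : ‖p.2‖ ^ 2 = ∫ x in Ω, ‖gradient ψ x‖ ^ 2 := by
      rw [Lp_norm_sq_eq_integral]
      refine integral_congr_ae ?_
      filter_upwards [h2] with x hx
      rw [hx]
    rw [← e1, ← e2] at key
    refine (sq_le_sq₀ (norm_nonneg _) (by positivity)).1 ?_
    linarith [mul_pow (2 * R) ‖p.2‖ 2, mul_pow 2 R 2]
  intro v
  exact closure_minimal hsub hcl v.2.2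

/-! ### POD projection and the data error formula. -/

section POD

variable {d : ℕ} {Ω : Set (Rd d)} {E : Type*} [NormedAddCommGroup E] [InnerProductSpace ℝ E]

lemma grad_injective_of_poincare {P : ℝ} (hP : ∀ v : H01 Ω, ‖toL2 v‖ ≤ P * ‖grad v‖) {v : H01 Ω}
    (hv : grad v = 0) : v = 0 := by
  have h : toL2 v = 0 := by
    have := hP v
    rw [hv, norm_zero, mul_zero] at this
    exact norm_le_zero_iff.1 this
  exact Subtype.ext (Prod.ext h hv)

lemma podProj_sub {m : ℕ} (φ : Fin m → H01 Ω) (r : ℕ) (v w : H01 Ω) :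
    podProj φ r (v - w) = podProj φ r v - podProj φ r w := by
  simp only [podProj, h01Inner, map_sub, inner_sub_left]
  rw [← Finset.sum_sub_distrib]
  exact Finset.sum_congr rfl fun i _ => by module

lemma podProj_smul {m : ℕ} (φ : Fin m → H01 Ω) (r : ℕ) (c : ℝ) (v : H01 Ω) :
    podProj φ r (c • v) = c • podProj φ r v := by
  simp only [podProj, h01Inner, map_smul, real_inner_smul_left, Finset.smul_sum, mul_smul]

lemma podProj_mem {m : ℕ} (φ : Fin m → H01 Ω) (r : ℕ) (v : H01 Ω) :
    podProj φ r v ∈ podSpace φ r :=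
  Submodule.sum_mem _ fun i hi => Submodule.smul_mem _ _ <|
    Submodule.subset_span ⟨i, (Finset.mem_filter.1 hi).2, rfl⟩

lemma inner_grad_sub_podProj {m : ℕ} {φ : Fin m → H01 Ω}
    (hφ : ∀ i k, h01Inner (φ i) (φ k) = if i = k then 1 else 0) (r : ℕ) (w : H01 Ω) {v : H01 Ω}
    (hv : v ∈ podSpace φ r) : inner ℝ (grad (w - podProj φ r w)) (grad v) = 0 := by
  induction hv using Submodule.span_induction with
  | mem v hv =>
    obtain ⟨k, hk, rfl⟩ := hv
    have hk : (k : ℕ) < r := hk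
    have : ∀ i, inner ℝ (grad (φ i)) (grad (φ k)) = if i = k then (1 : ℝ) else 0 :=
      fun i => hφ i k
    simp [podProj, inner_sub_left, sum_inner, real_inner_smul_left, this, h01Inner, hk]
  | zero => simp
  | add x y _ _ hx hy => rw [map_add, inner_add_right, hx, hy, add_zero]
  | smul c x _ hx => rw [map_smul, real_inner_smul_right, hx, mul_zero]

/-- The POD projection is the only Ritz projection onto the POD space. -/
lemma isRitzProjection_podSpace_iff {P : ℝ} (hP : ∀ v : H01 Ω, ‖toL2 v‖ ≤ P * ‖grad v‖) {m : ℕ}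
    {φ : Fin m → H01 Ω} (hφ : ∀ i k, h01Inner (φ i) (φ k) = if i = k then 1 else 0) (r : ℕ)
    (R : H01 Ω → H01 Ω) : IsRitzProjection (podSpace φ r) R ↔ R = podProj φ r := by
  constructor
  · intro hR
    funext w
    have hmem : R w - podProj φ r w ∈ podSpace φ r :=
      Submodule.sub_mem _ (hR w).1 (podProj_mem φ r w)
    have h1 := (hR w).2 _ hmem
    have h2 := inner_grad_sub_podProj hφ r w hmem
    -- The difference of two Ritz projections lies in the POD space and is orthogonal to all of it,
    -- hence to itself.
    have h3 : inner ℝ (grad (R w - podProj φ r w)) (grad (R w - podProj φ r w)) = (0 : ℝ) := by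
      rw [← sub_eq_zero.2 (h2.trans h1.symm), ← inner_sub_left, ← map_sub]
      congr 2
      abel
    exact sub_eq_zero.1 (grad_injective_of_poincare hP (inner_self_eq_zero.1 h3))
  · rintro rfl w
    exact ⟨podProj_mem φ r w, fun v hv => inner_grad_sub_podProj hφ r w hv⟩

/-- If `lam k` were positive, monotonicity would make the `k + 1` entries up to `k` positive,
exceeding the count `numPos lam`. The upper cutoff in `podTail` is therefore harmless. -/
lemma eq_zero_of_numPos_le {m : ℕ} {lam : Fin m → ℝ} (h0 : ∀ k, 0 ≤ lam k) (ha : Antitone lam)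
    {k : Fin m} (hk : numPos lam ≤ k) : lam k = 0 := by
  by_contra hne
  have hpos : 0 < lam k := lt_of_le_of_ne (h0 k) (Ne.symm hne)
  have hsub : Finset.Iic k ⊆ Finset.univ.filter fun i => 0 < lam i := fun i hi =>
    Finset.mem_filter.2 ⟨Finset.mem_univ _, hpos.trans_le (ha (Finset.mem_Iic.1 hi))⟩
  have := Finset.card_le_card hsub
  rw [Fin.card_Iic] at this
  unfold numPos at hk
  omega

lemma podTail_eq_sum {m : ℕ} {lam : Fin m → ℝ} (h0 : ∀ k, 0 ≤ lam k) (ha : Antitone lam) (r : ℕ)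
    (a : Fin m → ℝ) : podTail lam r a = ∑ i : Fin m, if r ≤ (i : ℕ) then lam i * a i else 0 := by
  rw [podTail, Finset.sum_filter]
  refine Finset.sum_congr rfl fun i _ => ?_
  by_cases h1 : r ≤ (i : ℕ)
  · by_cases h2 : (i : ℕ) < numPos lam
    · simp [h1, h2]
    · simp [eq_zero_of_numPos_le h0 ha (not_lt.1 h2)]
  · simp [h1]

lemma podTail_nonneg {m : ℕ} {lam : Fin m → ℝ} (h0 : ∀ k, 0 ≤ lam k) (r : ℕ)
    {a : Fin m → ℝ} (ha : ∀ i, 0 ≤ a i) : 0 ≤ podTail lam r a :=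
  Finset.sum_nonneg fun i _ => mul_nonneg (h0 i) (ha i)

lemma podTail_add {m : ℕ} (lam : Fin m → ℝ) (r : ℕ) (a b : Fin m → ℝ) :
    podTail lam r (fun i => a i + b i) = podTail lam r a + podTail lam r b := by
  simp only [podTail, mul_add, Finset.sum_add_distrib]

variable {M m : ℕ} {γ : Fin M → ℝ} {w : Fin M → H01 Ω} {lam : Fin m → ℝ} {f : Fin m → Fin M → ℝ}
  {φ : Fin m → H01 Ω}

/-- The data are recovered from the singular value decomposition. -/
lemma IsPODSVD.data_eq (h : IsPODSVD γ w lam f φ) {j : Fin M} (hγ : γ j ≠ 0) :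
    w j = ∑ k, (Real.sqrt (lam k) * f k j) • φ k := by
  -- Dividing by `γ j` compensates the weight both in the operator and in the inner product of `S`.
  have := h.expansion (Pi.single j (γ j)⁻¹)
  simpa [podOperator, weightedInner, Pi.single_apply, hγ] using this

lemma IsPODSVD.sub_podProj_eq (h : IsPODSVD γ w lam f φ) {j : Fin M} (hγ : γ j ≠ 0) (r : ℕ) :
    w j - podProj φ r (w j)
      = ∑ k : Fin m, (if r ≤ (k : ℕ) then Real.sqrt (lam k) * f k j else 0) • φ k := by
  have hc : ∀ i, h01Inner (w j) (φ i) = Real.sqrt (lam i) * f i j := by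
    intro i
    have : ∀ k, inner ℝ (grad (φ k)) (grad (φ i)) = if k = i then (1 : ℝ) else 0 :=
      fun k => h.orthonormal_X k i
    rw [h.data_eq hγ, h01Inner, map_sum, sum_inner]
    simp [real_inner_smul_left, this]
  simp only [podProj, hc]
  rw [h.data_eq hγ, Finset.sum_filter, ← Finset.sum_sub_distrib]
  refine Finset.sum_congr rfl fun k _ => ?_
  by_cases hk : (k : ℕ) < r
  · simp [hk, not_le.2 hk]
  · simp [hk, not_lt.1 hk]

/-- The POD data approximation error formula, in the seminorm induced by a linear map `L`. -/
lemma IsPODSVD.sum_norm_sq_error (h : IsPODSVD γ w lam f φ) (hγ : ∀ j, γ j ≠ 0) (r : ℕ)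
    (L : H01 Ω →ₗ[ℝ] E) :
    ∑ j, γ j * ‖L (w j - podProj φ r (w j))‖ ^ 2 = podTail lam r fun i => ‖L (φ i)‖ ^ 2 := by
  set t : Fin m → ℝ := fun k => if r ≤ (k : ℕ) then Real.sqrt (lam k) else 0 with ht
  have e1 : ∀ j, ‖L (w j - podProj φ r (w j))‖ ^ 2
      = ∑ k, ∑ l, t k * t l * inner ℝ (L (φ k)) (L (φ l)) * (f k j * f l j) := by
    intro j
    have : w j - podProj φ r (w j) = ∑ k, (t k * f k j) • φ k := by
      rw [h.sub_podProj_eq (hγ j)]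
      refine Finset.sum_congr rfl fun k _ => ?_
      simp only [ht, ite_mul, zero_mul]
    rw [this, ← real_inner_self_eq_norm_sq, map_sum L, sum_inner]
    refine Finset.sum_congr rfl fun k _ => ?_
    rw [inner_sum]
    refine Finset.sum_congr rfl fun l _ => ?_
    rw [map_smul, map_smul, real_inner_smul_left, real_inner_smul_right]
    ring
  -- Summing over `j` first leaves only the Gram matrix of the `f k` in `S`, so orthonormality
  -- removes the off-diagonal terms, although the `L (φ k)` need not be orthogonal.
  have e2 : ∑ j, γ j * ‖L (w j - podProj φ r (w j))‖ ^ 2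
      = ∑ k, ∑ l, t k * t l * inner ℝ (L (φ k)) (L (φ l)) * weightedInner γ (f k) (f l) := by
    simp only [e1, weightedInner, Finset.mul_sum]
    rw [Finset.sum_comm]
    refine Finset.sum_congr rfl fun k _ => ?_
    rw [Finset.sum_comm]
    refine Finset.sum_congr rfl fun l _ => Finset.sum_congr rfl fun j _ => ?_
    ring
  rw [e2, podTail_eq_sum h.nonneg h.antitone]
  refine Finset.sum_congr rfl fun k _ => ?_
  simp only [h.orthonormal_S, mul_ite, mul_one, mul_zero, Finset.sum_ite_eq, Finset.mem_univ,
    if_true, real_inner_self_eq_norm_sq]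
  by_cases hk : r ≤ (k : ℕ)
  · simp only [ht, hk, if_true, Real.mul_self_sqrt (h.nonneg k)]
  · simp [ht, hk]

end POD

/-! ### Discrete-time estimates. -/

section Estimates

variable {d : ℕ} {Ω : Set (Rd d)} {E : Type*} [NormedAddCommGroup E] [InnerProductSpace ℝ E]

/-- The error formula for the difference quotient data. -/
lemma IsPODSVD.dq1_error {M m : ℕ} {dt : ℝ} (hdt : 0 < dt) {u : ℕ → H01 Ω} {lam : Fin m → ℝ}
    {f : Fin m → Fin (M + 1) → ℝ} {φ : Fin m → H01 Ω}
    (h : IsPODSVD (dq1Weights (M + 1) dt) (dq1Data (M + 1) dt u) lam f φ) (r : ℕ)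
    (L : H01 Ω →ₗ[ℝ] E) :
    ‖L (u 1 - podProj φ r (u 1))‖ ^ 2
        + ∑ n ∈ Finset.range M,
          dt * ‖L (diffQuot dt (fun k => u k - podProj φ r (u k)) (n + 1))‖ ^ 2
      = podTail lam r fun i => ‖L (φ i)‖ ^ 2 := by
  rw [← h.sum_norm_sq_error (fun j => ?_) r L, Fin.sum_univ_succ, ← Fin.sum_univ_eq_sum_range
    (fun n => dt * ‖L (diffQuot dt (fun k => u k - podProj φ r (u k)) (n + 1))‖ ^ 2)]
  · congr 1
    · simp [dq1Weights, dq1Data]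
    · refine Finset.sum_congr rfl fun n _ => ?_
      simp only [dq1Weights, dq1Data, Fin.val_succ, Nat.succ_ne_zero, if_false, diffQuot,
        podProj_smul, podProj_sub]
      congr 4
      module
  · unfold dq1Weights
    split_ifs
    · exact one_ne_zero
    · exact hdt.ne'

lemma add_sum_le_add_sum {M : ℕ} {a b c : ℕ → ℝ} (h : ∀ n < M, a (n + 1) + b n ≤ a n + c n) :
    ∀ k ≤ M, a k + ∑ n ∈ Finset.range k, b n ≤ a 0 + ∑ n ∈ Finset.range k, c n := by
  intro k
  induction k with
  | zero => simp
  | succ k ih =>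
    intro hk
    rw [Finset.sum_range_succ, Finset.sum_range_succ]
    linarith [ih (by omega), h k (by omega)]

lemma norm_add_sq_le_two_mul (x y : E) : ‖x + y‖ ^ 2 ≤ 2 * ‖x‖ ^ 2 + 2 * ‖y‖ ^ 2 := by
  linarith [parallelogram_law_with_norm ℝ x y, sq_nonneg ‖x - y‖]

lemma norm_sub_sq_le_two_mul (x y : E) : ‖x - y‖ ^ 2 ≤ 2 * ‖x‖ ^ 2 + 2 * ‖y‖ ^ 2 := by
  linarith [parallelogram_law_with_norm ℝ x y, sq_nonneg ‖x + y‖]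

/-- A sequence is bounded pointwise by its initial value and its difference quotients. -/
lemma norm_sq_le_of_diffQuot (L : H01 Ω →ₗ[ℝ] E) {M : ℕ} {dt T : ℝ} (hdt : 0 < dt)
    (hT : (M : ℝ) * dt = T) (η : ℕ → H01 Ω) {k : ℕ} (hk : k ≤ M) :
    ‖L (η (k + 1))‖ ^ 2 ≤ 2 * (1 + T) *
      (‖L (η 1)‖ ^ 2 + ∑ n ∈ Finset.range M, dt * ‖L (diffQuot dt η (n + 1))‖ ^ 2) := by
  set S := ∑ n ∈ Finset.range M, dt * ‖L (diffQuot dt η (n + 1))‖ ^ 2 with hS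
  have hS0 : 0 ≤ S := Finset.sum_nonneg fun n _ => by positivity
  have hT0 : 0 ≤ T := by rw [← hT]; positivity
  have hstep : ∀ n, L (η (n + 1 + 1)) - L (η (n + 1)) = dt • L (diffQuot dt η (n + 1)) := by
    intro n
    rw [diffQuot, map_smul, smul_inv_smul₀ hdt.ne', map_sub]
  have hsum : L (η (k + 1)) = L (η 1) + ∑ n ∈ Finset.range k, dt • L (diffQuot dt η (n + 1)) := by
    simp only [← hstep]
    rw [Finset.sum_range_sub (fun n => L (η (n + 1)))]
    simp
  have hnorm : ‖∑ n ∈ Finset.range k, dt • L (diffQuot dt η (n + 1))‖ ^ 2 ≤ T * S := by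
    calc ‖∑ n ∈ Finset.range k, dt • L (diffQuot dt η (n + 1))‖ ^ 2
        ≤ (∑ n ∈ Finset.range k, ‖dt • L (diffQuot dt η (n + 1))‖) ^ 2 := by
          gcongr
          exact norm_sum_le _ _
      _ ≤ (∑ n ∈ Finset.range M, ‖dt • L (diffQuot dt η (n + 1))‖) ^ 2 := by
          gcongr
      -- Cauchy–Schwarz in time: the factor `M` combines with one factor `dt` to give `T`, so the
      -- bound is uniform in the time step.
      _ ≤ M * ∑ n ∈ Finset.range M, ‖dt • L (diffQuot dt η (n + 1))‖ ^ 2 := by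
          simpa using sq_sum_le_card_mul_sum_sq (s := Finset.range M)
            (f := fun n => ‖dt • L (diffQuot dt η (n + 1))‖)
      _ = T * S := by
          rw [hS, ← hT, mul_assoc]
          congr 1
          rw [Finset.mul_sum]
          refine Finset.sum_congr rfl fun n _ => ?_
          rw [norm_smul, Real.norm_of_nonneg hdt.le]
          ring
  rw [hsum]
  have := norm_add_sq_le_two_mul (L (η 1)) (∑ n ∈ Finset.range k, dt • L (diffQuot dt η (n + 1)))
  nlinarith [mul_nonneg hT0 (sq_nonneg ‖L (η 1)‖)]

/-- The error equation for `ur - Π_r u` in the POD space. -/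
lemma error_equation {m N : ℕ} {dt ν : ℝ} {Vh : Submodule ℝ (H01 Ω)} {F : ℕ → L2 Ω}
    {u ur : ℕ → H01 Ω} {φ : Fin m → H01 Ω} {r : ℕ} (hu : IsBackwardEuler Vh N dt ν F u)
    (hur : IsBackwardEuler (podSpace φ r) N dt ν F ur)
    (hφ : ∀ i k, h01Inner (φ i) (φ k) = if i = k then 1 else 0)
    (hVh : ∀ i : Fin m, (i : ℕ) < r → φ i ∈ Vh) {n : ℕ} (hn : n ∈ Finset.Icc 1 (N - 1))
    {v : H01 Ω} (hv : v ∈ podSpace φ r) :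
    inner ℝ (toL2 (diffQuot dt (fun k => ur k - podProj φ r (u k)) n)) (toL2 v)
        + ν * inner ℝ (grad (ur (n + 1) - podProj φ r (u (n + 1)))) (grad v)
      = inner ℝ (toL2 (diffQuot dt (fun k => u k - podProj φ r (u k)) n)) (toL2 v) := by
  have hle : podSpace φ r ≤ Vh := by
    refine Submodule.span_le.2 ?_
    rintro _ ⟨i, hi, rfl⟩
    exact hVh i hi
  have h1 := hu.2 n hn v (hle hv)
  have h2 := hur.2 n hn v hv
  -- This orthogonality leaves only the `L²` term of the projection error on the right-hand side.
  have h3 := inner_grad_sub_podProj hφ r (u (n + 1)) hv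
  have h4 : diffQuot dt (fun k => ur k - podProj φ r (u k)) n
      = diffQuot dt ur n - diffQuot dt u n + diffQuot dt (fun k => u k - podProj φ r (u k)) n := by
    simp only [diffQuot]
    module
  have h5 : ur (n + 1) - podProj φ r (u (n + 1))
      = ur (n + 1) - u (n + 1) + (u (n + 1) - podProj φ r (u (n + 1))) := by abel
  rw [h4, h5, map_add, map_sub, inner_add_left, inner_sub_left, map_add, inner_add_left, h3,
    map_sub, inner_sub_left]
  linarith

/-- One step of the energy estimate in `L²`, for the discrete heat equation with right-hand
side `g`. -/
lemma energy_step_L2 {P dt ν : ℝ} (hdt : 0 < dt) (hν : 0 < ν)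
    (hP : ∀ v : H01 Ω, ‖toL2 v‖ ≤ P * ‖grad v‖) {p : ℕ → H01 Ω} {g : L2 Ω} {n : ℕ}
    (h : inner ℝ (toL2 (diffQuot dt p n)) (toL2 (p (n + 1)))
        + ν * inner ℝ (grad (p (n + 1))) (grad (p (n + 1))) = inner ℝ g (toL2 (p (n + 1)))) :
    ‖toL2 (p (n + 1))‖ ^ 2 + ν * dt * ‖grad (p (n + 1))‖ ^ 2
      ≤ ‖toL2 (p n)‖ ^ 2 + P ^ 2 / ν * (dt * ‖g‖ ^ 2) := by
  rw [real_inner_self_eq_norm_sq, diffQuot, map_smul, real_inner_smul_left, map_sub,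
    inner_sub_left, real_inner_self_eq_norm_sq] at h
  set x := toL2 (p (n + 1))
  set y := toL2 (p n)
  set G := ‖grad (p (n + 1))‖ with hG
  have h1 : inner ℝ y x ≤ (‖y‖ ^ 2 + ‖x‖ ^ 2) / 2 := by
    nlinarith [real_inner_le_norm y x, sq_nonneg (‖y‖ - ‖x‖)]
  -- Young's weight is chosen so that, after doubling, exactly half of the dissipation `2 * ν * dt *
  -- G ^ 2` is absorbed and half survives.
  have h2 : inner ℝ g x ≤ P ^ 2 / (2 * ν) * ‖g‖ ^ 2 + ν / 2 * G ^ 2 := by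
    have a1 : inner ℝ g x ≤ ‖g‖ * (P * G) :=
      (real_inner_le_norm g x).trans (mul_le_mul_of_nonneg_left (hP _) (norm_nonneg _))
    have a2 : P ^ 2 / (2 * ν) * ‖g‖ ^ 2 + ν / 2 * G ^ 2 - ‖g‖ * (P * G)
        = (P * ‖g‖ - ν * G) ^ 2 / (2 * ν) := by
      field_simp
      ring
    have a3 : 0 ≤ (P * ‖g‖ - ν * G) ^ 2 / (2 * ν) := by positivity
    linarith
  have h3 : ‖x‖ ^ 2 - inner ℝ y x + dt * (ν * G ^ 2) = dt * inner ℝ g x := by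
    rw [← h, mul_add, mul_inv_cancel_left₀ hdt.ne']
  have h4 := mul_le_mul_of_nonneg_left h2 hdt.le
  have h5 : P ^ 2 / ν * (dt * ‖g‖ ^ 2) = 2 * (dt * (P ^ 2 / (2 * ν) * ‖g‖ ^ 2)) := by
    field_simp
  rw [h5]
  linarith

/-- One step of the energy estimate in `H¹₀`, for the discrete heat equation with right-hand
side `g`. -/
lemma energy_step_grad {dt ν : ℝ} (hdt : 0 < dt) (hν : 0 < ν) {p : ℕ → H01 Ω} {g : L2 Ω} {n : ℕ}
    (h : inner ℝ (toL2 (diffQuot dt p n)) (toL2 (diffQuot dt p n))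
        + ν * inner ℝ (grad (p (n + 1))) (grad (diffQuot dt p n))
      = inner ℝ g (toL2 (diffQuot dt p n))) :
    ‖grad (p (n + 1))‖ ^ 2 ≤ ‖grad (p n)‖ ^ 2 + 1 / ν * (dt * ‖g‖ ^ 2) := by
  have e : grad (diffQuot dt p n) = dt⁻¹ • (grad (p (n + 1)) - grad (p n)) := by
    rw [diffQuot, map_smul, map_sub]
  rw [real_inner_self_eq_norm_sq, e, real_inner_smul_right, inner_sub_right,
    real_inner_self_eq_norm_sq] at h
  set q := toL2 (diffQuot dt p n)
  set x := grad (p (n + 1))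
  set y := grad (p n)
  have h1 : inner ℝ x y ≤ (‖x‖ ^ 2 + ‖y‖ ^ 2) / 2 := by
    nlinarith [real_inner_le_norm x y, sq_nonneg (‖x‖ - ‖y‖)]
  -- The full `‖q‖ ^ 2` on the left of the equation is spent here; no control of `q` is kept.
  have h2 : inner ℝ g q ≤ ‖g‖ ^ 2 / 2 + ‖q‖ ^ 2 := by
    nlinarith [real_inner_le_norm g q, sq_nonneg (‖g‖ - ‖q‖), sq_nonneg ‖q‖]
  have h3 : ‖x‖ ^ 2 - inner ℝ x y = 1 / ν * (dt * (inner ℝ g q - ‖q‖ ^ 2)) := by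
    rw [← h]
    field_simp
    ring
  have h4 : 1 / ν * (dt * (inner ℝ g q - ‖q‖ ^ 2)) ≤ 1 / ν * (dt * (‖g‖ ^ 2 / 2)) := by
    gcongr
    linarith
  have h5 : 1 / ν * (dt * ‖g‖ ^ 2) = 2 * (1 / ν * (dt * (‖g‖ ^ 2 / 2))) := by ring
  rw [h5]
  linarith

end Estimates

/-! ### The error estimates for the reduced order model. -/

theorem mainTheorem8 (d : ℕ) (hd : 1 ≤ d) (Ω : Set (Rd d)) (hΩ : IsOpen Ω)
    (hΩb : Bornology.IsBounded Ω) (T ν : ℝ) (hT : 0 < T) (hν : 0 < ν) :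
    ∃ C : ℝ, 0 < C ∧
      ∀ (N : ℕ), 2 ≤ N →
      -- the conforming finite element space and the finite element solution
      ∀ (Vh : Submodule ℝ (H01 Ω)), FiniteDimensional ℝ Vh →
      ∀ (F : ℕ → L2 Ω) (u : ℕ → H01 Ω), IsBackwardEuler Vh N (timeStep T N) ν F u →
      -- the POD modes of the finite element solution, with POD space `H¹₀(Ω)`
      ∀ (m : ℕ) (lam : Fin m → ℝ) (f : Fin m → Fin N → ℝ) (φ : Fin m → H01 Ω),
      IsPODSVD (dq1Weights N (timeStep T N)) (dq1Data N (timeStep T N) u) lam f φ →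
      ∀ (r : ℕ), r ≤ m → (∀ i : Fin m, (i : ℕ) < r → φ i ∈ Vh) →
      -- the solution of the reduced order model
      ∀ (ur : ℕ → H01 Ω), IsBackwardEuler (podSpace φ r) N (timeStep T N) ν F ur →
      -- the Ritz projection is the POD projection
      (∀ R : H01 Ω → H01 Ω, IsRitzProjection (podSpace φ r) R ↔ R = podProj φ r) ∧
      -- pointwise `L²` error
      (∀ k ∈ Finset.Icc 1 N, ‖toL2 (u k - ur k)‖ ^ 2 ≤
        C * (podTail lam r (fun i => ‖toL2 (φ i)‖ ^ 2)
          + ‖toL2 (ur 1 - podProj φ r (u 1))‖ ^ 2)) ∧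
      -- pointwise `H¹₀` error
      (∀ k ∈ Finset.Icc 1 N, ‖grad (u k - ur k)‖ ^ 2 ≤
        C * (podTail lam r (fun i => ‖toL2 (φ i)‖ ^ 2 + 1)
          + ‖grad (ur 1 - podProj φ r (u 1))‖ ^ 2)) ∧
      -- solution norm error
      (‖toL2 (u N - ur N)‖ ^ 2
          + ν * timeStep T N * ∑ n ∈ Finset.Icc 1 (N - 1), ‖grad (u (n + 1) - ur (n + 1))‖ ^ 2 ≤
        C * (podTail lam r (fun i => 1 + ‖toL2 (φ i)‖ ^ 2)
          + ‖toL2 (ur 1 - podProj φ r (u 1))‖ ^ 2)) := by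
  obtain ⟨P, hP⟩ := exists_poincare hd hΩ hΩb
  -- The sum of all coefficients met below, doubled by splitting `η - p`: `2 * (1 + T)` from
  -- pointwise `η`, `1` from `p 1`, `P ^ 2 / ν` and `1 / ν` from the energy steps, and `2 * (ν * T *
  -- (1 + T))` from the time-summed gradient of `η`.
  set C : ℝ := 4 * (1 + T) + 2 + 2 * (P ^ 2 / ν) + 2 * (1 / ν) + 4 * (ν * T * (1 + T)) with hC
  have c2 : 0 ≤ P ^ 2 / ν := by positivity
  have c3 : 0 ≤ 1 / ν := by positivity
  have c4 : 0 ≤ ν * T * (1 + T) := by positivity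
  refine ⟨C, by positivity, ?_⟩
  intro N hN Vh _ F u hu m lam f φ hsvd r _ hVh ur hur
  obtain ⟨M, rfl⟩ : ∃ M, N = M + 1 := ⟨N - 1, by omega⟩
  have hM : 0 < (M : ℝ) := by
    have : 0 < M := by omega
    exact_mod_cast this
  set dt := timeStep T (M + 1) with hdt_def
  have hdt_eq : dt = T / M := by simp [hdt_def, timeStep]
  have hdt : 0 < dt := by rw [hdt_eq]; positivity
  have hMdt : (M : ℝ) * dt = T := by rw [hdt_eq]; field_simp
  set η : ℕ → H01 Ω := fun k => u k - podProj φ r (u k) with hη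
  set p : ℕ → H01 Ω := fun k => ur k - podProj φ r (u k) with hp
  have hX := hsvd.orthonormal_X
  have he : ∀ k, u k - ur k = η k - p k := fun k => by simp only [hη, hp]; abel
  have tL := hsvd.dq1_error hdt r toL2
  have tH := hsvd.dq1_error hdt r grad
  set tailL := podTail lam r fun i => ‖toL2 (φ i)‖ ^ 2 with htailL
  set tailH := podTail lam r fun i => ‖grad (φ i)‖ ^ 2 with htailH
  have hLnn : 0 ≤ tailL := podTail_nonneg hsvd.nonneg r fun i => by positivity
  have hHnn : 0 ≤ tailH := podTail_nonneg hsvd.nonneg r fun i => by positivity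
  have hone : ∀ i, ‖grad (φ i)‖ ^ 2 = 1 := fun i => by
    rw [← real_inner_self_eq_norm_sq]
    exact (hX i i).trans (if_pos rfl)
  -- The modes are `H¹₀`-normalised, so the summand `1` in the stated bounds is the `H¹₀` tail.
  have htailH1 : podTail lam r (fun _ => 1) = tailH := by simp only [htailH, hone]
  have ηL : ∀ k ≤ M, ‖toL2 (η (k + 1))‖ ^ 2 ≤ 2 * (1 + T) * tailL := fun k hk => by
    rw [← tL]
    exact norm_sq_le_of_diffQuot toL2 hdt hMdt η hk
  have ηH : ∀ k ≤ M, ‖grad (η (k + 1))‖ ^ 2 ≤ 2 * (1 + T) * tailH := fun k hk => by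
    rw [← tH]
    exact norm_sq_le_of_diffQuot grad hdt hMdt η hk
  have hsumL : ∀ k ≤ M,
      ∑ n ∈ Finset.range k, dt * ‖toL2 (diffQuot dt η (n + 1))‖ ^ 2 ≤ tailL := fun k hk => by
    rw [← tL]
    refine le_trans ?_ (le_add_of_nonneg_left (sq_nonneg _))
    refine Finset.sum_le_sum_of_subset_of_nonneg (Finset.range_mono hk) fun n _ _ => ?_
    positivity
  have hpmem : ∀ k ∈ Finset.Icc 1 (M + 1), p k ∈ podSpace φ r := fun k hk =>
    Submodule.sub_mem _ (hur.1 k hk) (podProj_mem φ r _)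
  have pL : ∀ k ≤ M, ‖toL2 (p (k + 1))‖ ^ 2
      + ∑ n ∈ Finset.range k, ν * dt * ‖grad (p (n + 1 + 1))‖ ^ 2
        ≤ ‖toL2 (p 1)‖ ^ 2 + P ^ 2 / ν * tailL := by
    intro k hk
    have := add_sum_le_add_sum (M := M) (a := fun n => ‖toL2 (p (n + 1))‖ ^ 2)
      (b := fun n => ν * dt * ‖grad (p (n + 1 + 1))‖ ^ 2)
      (c := fun n => P ^ 2 / ν * (dt * ‖toL2 (diffQuot dt η (n + 1))‖ ^ 2))
      -- The error equation is tested with `p` at the new time level.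
      (fun n hn => energy_step_L2 hdt hν hP <| error_equation hu hur hX hVh
        (Finset.mem_Icc.2 ⟨by omega, by omega⟩) (hpmem _ (Finset.mem_Icc.2 ⟨by omega, by omega⟩)))
      k hk
    rw [← Finset.mul_sum _ _ (P ^ 2 / ν)] at this
    refine this.trans ?_
    have := mul_le_mul_of_nonneg_left (hsumL k hk) c2
    linarith
  have pH : ∀ k ≤ M, ‖grad (p (k + 1))‖ ^ 2 ≤ ‖grad (p 1)‖ ^ 2 + 1 / ν * tailL := by
    intro k hk
    have := add_sum_le_add_sum (M := M) (a := fun n => ‖grad (p (n + 1))‖ ^ 2)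
      (b := fun _ => 0)
      (c := fun n => 1 / ν * (dt * ‖toL2 (diffQuot dt η (n + 1))‖ ^ 2))
      (fun n hn => by
        rw [add_zero]
        refine energy_step_grad hdt hν <| error_equation hu hur hX hVh
          (Finset.mem_Icc.2 ⟨by omega, by omega⟩) ?_
        -- The test function is now the difference quotient of `p`, admissible because both time
        -- levels of `p` lie in the POD space.
        exact Submodule.smul_mem _ _ <| Submodule.sub_mem _
          (hpmem _ (Finset.mem_Icc.2 ⟨by omega, by omega⟩))
          (hpmem _ (Finset.mem_Icc.2 ⟨by omega, by omega⟩)))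
      k hk
    rw [← Finset.mul_sum, Finset.sum_const_zero, add_zero] at this
    refine this.trans ?_
    have := mul_le_mul_of_nonneg_left (hsumL k hk) c3
    linarith
  have q1 : 0 ≤ ‖toL2 (p 1)‖ ^ 2 := sq_nonneg _
  have q2 : 0 ≤ ‖grad (p 1)‖ ^ 2 := sq_nonneg _
  have k1 : 4 * (1 + T) + 2 * (P ^ 2 / ν) ≤ C := by rw [hC]; linarith
  have k2 : 2 ≤ C := by rw [hC]; linarith
  have k3 : 4 * (1 + T) + 4 * (ν * T * (1 + T)) ≤ C := by rw [hC]; linarith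
  have k4 : 2 * (1 / ν) ≤ C := by rw [hC]; linarith
  refine ⟨isRitzProjection_podSpace_iff hP hX r, ?_, ?_, ?_⟩
  · intro k hk
    obtain ⟨j, rfl⟩ : ∃ j, k = j + 1 := ⟨k - 1, by have := Finset.mem_Icc.1 hk; omega⟩
    have hj : j ≤ M := by have := Finset.mem_Icc.1 hk; omega
    have h1 := norm_sub_sq_le_two_mul (toL2 (η (j + 1))) (toL2 (p (j + 1)))
    have h2 := ηL j hj
    have h3 := pL j hj
    have h4 : 0 ≤ ∑ n ∈ Finset.range j, ν * dt * ‖grad (p (n + 1 + 1))‖ ^ 2 :=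
      Finset.sum_nonneg fun n _ => by positivity
    rw [he, map_sub]
    have h5 := mul_le_mul_of_nonneg_right k1 hLnn
    have h6 := mul_le_mul_of_nonneg_right k2 q1
    change _ ≤ C * (tailL + ‖toL2 (p 1)‖ ^ 2)
    linarith
  · intro k hk
    obtain ⟨j, rfl⟩ : ∃ j, k = j + 1 := ⟨k - 1, by have := Finset.mem_Icc.1 hk; omega⟩
    have hj : j ≤ M := by have := Finset.mem_Icc.1 hk; omega
    have h1 := norm_sub_sq_le_two_mul (grad (η (j + 1))) (grad (p (j + 1)))
    have h2 := ηH j hj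
    have h3 := pH j hj
    rw [he, map_sub, podTail_add, htailH1]
    have h4 := mul_le_mul_of_nonneg_right k3 hHnn
    have h5 := mul_le_mul_of_nonneg_right k4 hLnn
    have h6 := mul_le_mul_of_nonneg_right k2 q2
    have h7 := mul_nonneg c4 hHnn
    change _ ≤ C * (tailL + tailH + ‖grad (p 1)‖ ^ 2)
    linarith
  · have h1 := norm_sub_sq_le_two_mul (toL2 (η (M + 1))) (toL2 (p (M + 1)))
    have h2 := ηL M le_rfl
    have h3 := pL M le_rfl
    have hsum : ∑ n ∈ Finset.Icc 1 (M + 1 - 1), ‖grad (u (n + 1) - ur (n + 1))‖ ^ 2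
        = ∑ n ∈ Finset.range M, ‖grad (η (n + 1 + 1)) - grad (p (n + 1 + 1))‖ ^ 2 := by
      rw [Nat.add_sub_cancel, Finset.range_eq_Ico, Finset.sum_Ico_add'
        (fun n => ‖grad (η (n + 1)) - grad (p (n + 1))‖ ^ 2) 0 M 1]
      refine Finset.sum_congr ?_ fun n _ => by rw [he, map_sub]
      ext n
      simp only [Finset.mem_Icc, Finset.mem_Ico]
      omega
    have h4 : ν * dt * ∑ n ∈ Finset.range M, ‖grad (η (n + 1 + 1)) - grad (p (n + 1 + 1))‖ ^ 2
        ≤ 4 * (ν * T * (1 + T)) * tailH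
          + 2 * ∑ n ∈ Finset.range M, ν * dt * ‖grad (p (n + 1 + 1))‖ ^ 2 := by
      -- The pointwise bound on the gradient of `η` is summed over `M` steps, and `M * dt = T`.
      have e : 4 * (ν * T * (1 + T)) * tailH
          = ∑ n ∈ Finset.range M, ν * dt * (2 * (2 * (1 + T) * tailH)) := by
        rw [Finset.sum_const, Finset.card_range, nsmul_eq_mul, ← hMdt]
        ring
      rw [e, Finset.mul_sum, Finset.mul_sum, ← Finset.sum_add_distrib]
      refine Finset.sum_le_sum fun n hn => ?_
      have a1 := norm_sub_sq_le_two_mul (grad (η (n + 1 + 1))) (grad (p (n + 1 + 1)))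
      have a2 := ηH (n + 1) (Finset.mem_range.1 hn)
      have a3 : ‖grad (η (n + 1 + 1)) - grad (p (n + 1 + 1))‖ ^ 2
          ≤ 2 * (2 * (1 + T) * tailH) + 2 * ‖grad (p (n + 1 + 1))‖ ^ 2 := by linarith
      have a4 := mul_le_mul_of_nonneg_left a3 (mul_pos hν hdt).le
      linarith
    rw [he, map_sub, hsum, podTail_add, htailH1]
    have h5 := mul_le_mul_of_nonneg_right k1 hLnn
    have h6 := mul_le_mul_of_nonneg_right k2 q1
    have h7 := mul_le_mul_of_nonneg_right k3 hHnn
    have h8 := mul_nonneg hT.le hHnn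
    change _ ≤ C * (tailH + tailL + ‖toL2 (p 1)‖ ^ 2)
    linarith
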